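/- Let $p\ge 3$ be a prime number, let $G$ be the normalizer of the diagonal subgroup of $\mathrm{GL}_2(\mathbb F_p)$, let $\Gamma\subset \mathrm{SL}_2(\mathbb Z)$ be the inverse image of $G\cap \mathrm{SL}_2(\mathbb F_p)$, and let $Y_G(\mathbb C)=\Gamma\backslash\mathcal H$, where $\mathcal H$ is the upper half-plane. Let $j$ be the modular invariant. For $\mathbf a=(a_1,a_2)\in\mathbb Q^2\setminus\mathbb Z^2$ let $g_{\mathbf a}$ be the Siegel function $$g_{\mathbf a}(\tau)=-q^{B_2(a_1)/2}e^{\pi i a_2(a_1-1)}\prod_{n=0}^\infty\bigl(1-q^{n+a_1}e^{2\pi i a_2}\bigr)\bigl(1-q^{n+1-a_1}e^{-2\pi i a_2}\bigr),\qquad \tau\in\mathcal H,$$ where $q^r=e^{2\pi i r\tau}$ and $B_2(T)=T^2-T+\tfrac16$. For non-zero $\mathbf a\in(p^{-1}\mathbb Z/\mathbb Z)^2$ put $u_{\mathbf a}=g_{\mathbf a}^{12p}$ (this does not depend on the lift of $\mathbf a$ to $\mathbb Q^2$). Let $A$ be the set of all $(a,0)$ and $(0,a)$ with $a$ a non-zero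 element of $p^{-1}\mathbb Z/\mathbb Z$, and let $$U=\prod_{\mathbf a\in A}u_{\mathbf a}.$$ The functions $j$ and $U$ are $\Gamma$-invariant on $\mathcal H$ and so define functions on $Y_G(\mathbb C)$. Then for every $P\in Y_G(\mathbb C)$ we have either $$\log|j(P)|\le 2\pi\sqrt p+6\log p+O(1)$$ or $$\log|j(P)|\le \frac1{2(p-1)}\bigl|\log|U(P)|\bigr|+2\pi\sqrt p-6\log p+O(1),$$ where the constants implied by $O(1)$ are absolute (they depend neither on $p$ nor on $P$). -/

import Mathlib

noncomputable section

namespace SplitCartan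

open Complex
open scoped MatrixGroups

/-- The diagonal subgroup of `GL₂(𝔽_p)` (the units of the ring of diagonal matrices). -/
def diagonalSubgroup (p : ℕ) : Subgroup (GL (Fin 2) (ZMod p)) :=
  (Units.map (Matrix.diagonalRingHom (Fin 2) (ZMod p)).toMonoidHom).range

/-- The normalizer `G` of the diagonal subgroup of `GL₂(𝔽_p)`. -/
def G (p : ℕ) : Subgroup (GL (Fin 2) (ZMod p)) :=
  Subgroup.normalizer (diagonalSubgroup p : Set (GL (Fin 2) (ZMod p)))

/-- The pullback `Γ` of `G ∩ SL₂(𝔽_p)` to `SL₂(ℤ)`. -/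
def Γ (p : ℕ) : Subgroup SL(2, ℤ) :=
  (G p).comap (Matrix.SpecialLinearGroup.toGL.comp
    (Matrix.SpecialLinearGroup.map (Int.castRingHom (ZMod p))))

/-- The set of complex points `Y_G(ℂ) = Γ \ ℍ` of the modular curve of `G` without its cusps. -/
abbrev Y (p : ℕ) : Type := MulAction.orbitRel.Quotient (Γ p) UpperHalfPlane

/-- The modular invariant `j = E₄³ / Δ = 1728 E₄³ / (E₄³ - E₆²)` on the upper half-plane. -/
def jInv (τ : UpperHalfPlane) : ℂ :=
  ModularForm.E₄ τ ^ 3 / ModularForm.discriminant τ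

theorem discriminant_smul (γ : SL(2, ℤ)) (τ : UpperHalfPlane) :
    ModularForm.discriminant (γ • τ) =
      ((γ 1 0 : ℂ) * τ + γ 1 1) ^ 12 * ModularForm.discriminant τ := by
  have h := SlashInvariantForm.slash_action_eqn'' CuspForm.discriminant
    (MonoidHom.mem_range.mpr ⟨γ, rfl⟩ : Matrix.SpecialLinearGroup.mapGL ℝ γ ∈ 𝒮ℒ) τ
  rw [CuspForm.coe_discriminant] at h
  change ModularForm.discriminant (γ • τ) = _ at h
  rw [h]
  congr 1

theorem jInv_smul (γ : SL(2, ℤ)) (τ : UpperHalfPlane) : jInv (γ • τ) = jInv τ := by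
  have h := SlashInvariantForm.slash_action_eqn'' ModularForm.E₄
    (MonoidHom.mem_range.mpr ⟨γ, rfl⟩ : Matrix.SpecialLinearGroup.mapGL ℝ γ ∈ 𝒮ℒ) τ
  have h2 := SlashInvariantForm.slash_action_eqn'' CuspForm.discriminant
    (MonoidHom.mem_range.mpr ⟨γ, rfl⟩ : Matrix.SpecialLinearGroup.mapGL ℝ γ ∈ 𝒮ℒ) τ
  have h3 := UpperHalfPlane.denom_ne_zero (Matrix.SpecialLinearGroup.mapGL ℝ γ) τ
  have h4 := ModularForm.discriminant_ne_zero τ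
  rw [CuspForm.coe_discriminant] at h2
  change ModularForm.E₄ (γ • τ) = _ at h
  change ModularForm.discriminant (γ • τ) = _ at h2
  rw [jInv, jInv, h, h2]
  have : (UpperHalfPlane.denom (Matrix.SpecialLinearGroup.mapGL ℝ γ) τ ^ (4 : ℤ)) ^ 3
    = UpperHalfPlane.denom (Matrix.SpecialLinearGroup.mapGL ℝ γ) τ ^ (12 : ℤ) := by
    rw [← zpow_natCast, ← zpow_mul]; norm_num
  rw [mul_pow, this, mul_div_mul_left _ _ (zpow_ne_zero _ h3)]

theorem entries_of_mem_Γ {p : ℕ} [Fact p.Prime] (hp : 3 ≤ p) {γ : SL(2, ℤ)} (hγ : γ ∈ Γ p) :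
    ((p : ℤ) ∣ γ 0 1 ∧ (p : ℤ) ∣ γ 1 0) ∨ ((p : ℤ) ∣ γ 0 0 ∧ (p : ℤ) ∣ γ 1 1) := by
  have h2 : (2 : ZMod p) ≠ 0 := by
    have := (ZMod.natCast_eq_zero_iff 2 p).not.mpr (fun h => by have := Nat.le_of_dvd two_pos h; omega)
    exact_mod_cast this
  set g : GL (Fin 2) (ZMod p) := (Matrix.SpecialLinearGroup.toGL.comp
    (Matrix.SpecialLinearGroup.map (Int.castRingHom (ZMod p)))) γ with hg
  have hgN : g ∈ G p := hγ
  let t : GL (Fin 2) (ZMod p) := Units.map (Matrix.diagonalRingHom (Fin 2) (ZMod p)).toMonoidHom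
    (MulEquiv.piUnits.symm ![1, -1])
  have ht : t ∈ diagonalSubgroup p := ⟨_, rfl⟩
  have hn := (hgN t).mp ht
  obtain ⟨d, hd⟩ := hn
  have hd' : (Matrix.diagonal (d : Fin 2 → ZMod p)) * (g : Matrix (Fin 2) (Fin 2) (ZMod p)) =
      g * (t : Matrix (Fin 2) (Fin 2) (ZMod p)) := by
    have : (Units.map (Matrix.diagonalRingHom (Fin 2) (ZMod p)).toMonoidHom d) * g = g * t := by
      rw [hd]; group
    exact congrArg Units.val this
  have htm : (t : Matrix (Fin 2) (Fin 2) (ZMod p)) = Matrix.diagonal ![1, -1] := by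
    ext i j; fin_cases i <;> fin_cases j <;> simp [t, Matrix.diagonal]
  have hgm : ∀ i j, (g : Matrix (Fin 2) (Fin 2) (ZMod p)) i j = (γ i j : ZMod p) := by
    intro i j; simp [hg]
  rw [htm] at hd'
  have e : ∀ i j, (d : Fin 2 → ZMod p) i * (γ i j : ZMod p) = (γ i j : ZMod p) * (![1, -1] j) := by
    intro i j
    have := congrFun (congrFun hd' i) j
    rwa [Matrix.diagonal_mul, Matrix.mul_diagonal, hgm] at this
  have hdet : (γ 0 0 : ZMod p) * γ 1 1 - γ 0 1 * γ 1 0 = 1 := by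
    have := γ.det_coe
    rw [Matrix.det_fin_two] at this
    exact_mod_cast congrArg (Int.cast : ℤ → ZMod p) this
  have e00 := e 0 0
  have e01 := e 0 1
  have e10 := e 1 0
  have e11 := e 1 1
  simp only [Matrix.cons_val_zero, Matrix.cons_val_one] at e00 e01 e10 e11
  have k0 : (γ 0 0 : ZMod p) * γ 0 1 = 0 := by
    have : (2 : ZMod p) * (γ 0 0 * γ 0 1) = 0 := by linear_combination (γ 0 0 : ZMod p) * e01 - (γ 0 1 : ZMod p) * e00
    simpa [h2] using this
  have k1 : (γ 1 0 : ZMod p) * γ 1 1 = 0 := by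
    have : (2 : ZMod p) * (γ 1 0 * γ 1 1) = 0 := by linear_combination (γ 1 0 : ZMod p) * e11 - (γ 1 1 : ZMod p) * e10
    simpa [h2] using this
  simp only [← ZMod.intCast_zmod_eq_zero_iff_dvd]
  grind

/-- `q^r = e^{2πirτ}` for rational `r`. -/
def qpow (τ : UpperHalfPlane) (r : ℚ) : ℂ :=
  cexp (2 * Real.pi * I * r * τ)

/-- The Siegel function
`g_a(τ) = -q^{B₂(a₁)/2} e^{πi a₂(a₁-1)} ∏_{n ≥ 0} (1 - q^{n+a₁} e^{2πi a₂}) (1 - q^{n+1-a₁} e^{-2πi a₂})`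
where `B₂(T) = T² - T + 1/6`. The product converges absolutely for all `τ` in the upper
half-plane. -/
def siegel (a : Fin 2 → ℚ) (τ : UpperHalfPlane) : ℂ :=
  -qpow τ ((a 0 ^ 2 - a 0 + 1 / 6) / 2) * cexp (Real.pi * I * a 1 * (a 0 - 1)) *
    ∏' n : ℕ, (1 - qpow τ (n + a 0) * cexp (2 * Real.pi * I * a 1)) *
      (1 - qpow τ (n + 1 - a 0) * cexp (-(2 * Real.pi * I * a 1)))

theorem qpow_add (τ : UpperHalfPlane) (r s : ℚ) : qpow τ (r + s) = qpow τ r * qpow τ s := by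
  rw [qpow, qpow, qpow, ← Complex.exp_add]; push_cast; ring_nf

theorem qpow_nat_mul (τ : UpperHalfPlane) (n : ℕ) (r : ℚ) : qpow τ (n * r) = qpow τ r ^ n := by
  rw [qpow, qpow, ← Complex.exp_nat_mul]; push_cast; ring_nf

theorem norm_qpow_lt_one (τ : UpperHalfPlane) {r : ℚ} (hr : 0 < r) : ‖qpow τ r‖ < 1 := by
  rw [qpow, Complex.norm_exp, Real.exp_lt_one_iff]
  have h : (2 * Real.pi * I * r * τ : ℂ) = ((2 * Real.pi * r : ℝ) : ℂ) * (I * τ) := by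
    push_cast; ring
  rw [h, Complex.re_ofReal_mul]
  have h1 : 0 < (r : ℝ) := by exact_mod_cast hr
  have h2 := τ.im_pos
  have h3 : (I * (τ : ℂ)).re = -τ.im := by simp
  rw [h3]
  have := mul_pos (mul_pos Real.two_pi_pos h1) h2
  linarith

/-- The Euler product `∏_{n ≥ 1} (1 - x^n)`. -/
def eulerProd (x : ℂ) : ℂ := ∏' n : ℕ, (1 - x ^ (n + 1))

theorem multipliable_one_sub_mul {x : ℂ} (hx : ‖x‖ < 1) (c : ℂ) :
    Multipliable fun n : ℕ => 1 - x ^ n * c := by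
  simp only [sub_eq_add_neg]
  apply multipliable_one_add_of_summable
  simp only [norm_neg, norm_mul, norm_pow]
  exact (summable_geometric_of_lt_one (norm_nonneg _) hx).mul_right _

theorem eulerProd_ne_zero {x : ℂ} (hx : ‖x‖ < 1) : eulerProd x ≠ 0 := by
  have := tprod_one_add_ne_zero_of_summable (f := fun n : ℕ => -x ^ (n + 1)) ?_ ?_
  · simpa [eulerProd, sub_eq_add_neg] using this
  · intro n h
    have h1 : x ^ (n + 1) = 1 := by
      have h' : 1 + -x ^ (n + 1) = 0 := h
      linear_combination -h'
    have h2 : ‖x‖ ^ (n + 1) < 1 := pow_lt_one₀ (norm_nonneg _) hx (by omega)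
    rw [← norm_pow, h1] at h2
    simp at h2
  · simpa using (summable_nat_add_iff 1).mpr (summable_geometric_of_lt_one (norm_nonneg _) hx)

theorem eta_pow_eq (z : ℂ) :
    ModularForm.eta z ^ 24 =
      cexp (2 * Real.pi * I * z) * eulerProd (cexp (2 * Real.pi * I * z)) ^ 24 := by
  have h : ModularForm.eta z =
      Function.Periodic.qParam 24 z * eulerProd (cexp (2 * Real.pi * I * z)) := by
    simp only [eulerProd, ModularForm.eta, ModularForm.eta_q_eq_pow]
  have h2 : Function.Periodic.qParam 24 z ^ 24 = cexp (2 * Real.pi * I * z) := by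
    rw [Function.Periodic.qParam, ← Complex.exp_nat_mul]
    congr 1; push_cast; ring
  rw [h, mul_pow, h2]

theorem block_aux (x : ℂ) (m n : ℕ) :
    (∏ k ∈ Finset.range m, (1 - x ^ ((m + 1) * n + k + 1))) * (1 - (x ^ (m + 1)) ^ (n + 1)) =
      ∏ k ∈ Finset.range (m + 1), (1 - x ^ (n * (m + 1) + k + 1)) := by
  have h : (m + 1) * (n + 1) = n * (m + 1) + m + 1 := by ring
  rw [Finset.prod_range_succ, ← pow_mul x (m + 1) (n + 1), h, mul_comm n (m + 1)]

theorem divMod_tprod (f : ℕ → ℂ) (m : ℕ) :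
    ∏' n : ℕ, f n = ∏' c : ℕ × Fin (m + 1), f (c.1 * (m + 1) + (c.2 : ℕ)) :=
  ((Nat.divModEquiv (m + 1)).symm.tprod_eq f).symm

theorem divMod_multipliable {f : ℕ → ℂ} (m : ℕ) (hf : Multipliable f) :
    Multipliable fun c : ℕ × Fin (m + 1) => f (c.1 * (m + 1) + (c.2 : ℕ)) :=
  (Nat.divModEquiv (m + 1)).symm.multipliable_iff.mpr hf

/-- Regrouping the Euler product in blocks of length `m + 1`. -/
theorem tprod_block {x : ℂ} (hx : ‖x‖ < 1) (m : ℕ) :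
    (∏' n : ℕ, ∏ k ∈ Finset.range m, (1 - x ^ ((m + 1) * n + k + 1))) *
      eulerProd (x ^ (m + 1)) = eulerProd x := by
  have hx' : ‖x ^ (m + 1)‖ < 1 := by
    rw [norm_pow]; exact pow_lt_one₀ (norm_nonneg _) hx (by omega)
  have hm : ∀ k, Multipliable fun n : ℕ => 1 - x ^ ((m + 1) * n + k + 1) := fun k => by
    refine (multipliable_one_sub_mul hx' (x ^ (k + 1))).congr fun n => ?_
    rw [← pow_mul, ← pow_add, add_assoc]
  have h0 := ModularForm.multipliable_one_sub_pow hx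
  have h1 := divMod_tprod (fun n => 1 - x ^ (n + 1)) m
  have h2 := divMod_multipliable m h0
  have h3 := h2.tprod_prod' fun n => (hasProd_fintype _).multipliable
  have h4 : ∀ n : ℕ, ∏' k : Fin (m + 1), (1 - x ^ (n * (m + 1) + (k : ℕ) + 1)) =
      (∏ k ∈ Finset.range m, (1 - x ^ ((m + 1) * n + k + 1))) *
        (1 - (x ^ (m + 1)) ^ (n + 1)) := fun n => by
    rw [tprod_fintype, block_aux, Finset.prod_range]
  have h5 := Multipliable.tprod_mul (multipliable_prod fun k (_ : k ∈ Finset.range m) => hm k)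
    (ModularForm.multipliable_one_sub_pow hx')
  rw [eulerProd, eulerProd, ← h5, h1, h3]
  exact tprod_congr fun n => (h4 n).symm

theorem prod_one_sub_mul {m : ℕ} {ζ : ℂ} (hζ : IsPrimitiveRoot ζ (m + 1)) (x : ℂ) :
    (∏ k ∈ Finset.range m, (1 - x * ζ ^ (k + 1))) * (1 - x) = 1 - x ^ (m + 1) := by
  have h := X_pow_sub_C_eq_prod hζ m.succ_pos (α := x) rfl
  have h' := congrArg (Polynomial.eval 1) h
  simp only [Polynomial.eval_sub, Polynomial.eval_pow, Polynomial.eval_X, Polynomial.eval_C,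
    Polynomial.eval_prod, one_pow] at h'
  rw [h', Finset.prod_range_succ']
  simp [mul_comm]

theorem tprod_root {m : ℕ} {ζ : ℂ} (hζ : IsPrimitiveRoot ζ (m + 1)) {x : ℂ} (hx : ‖x‖ < 1) :
    (∏ k ∈ Finset.range m, ∏' n : ℕ, (1 - x ^ (n + 1) * ζ ^ (k + 1))) * eulerProd x =
      eulerProd (x ^ (m + 1)) := by
  have hm : ∀ k, Multipliable fun n : ℕ => 1 - x ^ (n + 1) * ζ ^ (k + 1) := fun k => by
    refine (multipliable_one_sub_mul hx (x * ζ ^ (k + 1))).congr fun n => ?_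
    ring
  rw [← Multipliable.tprod_finsetProd fun k _ => hm k, eulerProd, eulerProd,
    ← Multipliable.tprod_mul]
  · refine tprod_congr fun n => ?_
    rw [prod_one_sub_mul hζ, ← pow_mul, ← pow_mul, mul_comm]
  · exact multipliable_prod fun k _ => hm k
  · exact ModularForm.multipliable_one_sub_pow hx

theorem siegel_right {m : ℕ} {ζ : ℂ} (hζ : ζ = cexp (2 * Real.pi * I / (m + 1 : ℕ)))
    (τ : UpperHalfPlane) (k : ℕ) :
    siegel ![0, ((k + 1 : ℕ) : ℚ) / (m + 1 : ℕ)] τ =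
      (-qpow τ (1 / 12) * cexp (-(Real.pi * I * (k + 1 : ℕ) / (m + 1 : ℕ)))) *
      ((1 - ζ ^ (k + 1)) * ((∏' n : ℕ, (1 - qpow τ 1 ^ (n + 1) * ζ ^ (k + 1))) *
        ∏' n : ℕ, (1 - qpow τ 1 ^ (n + 1) * ζ⁻¹ ^ (k + 1)))) := by
  have hq := norm_qpow_lt_one τ one_pos
  have hz : cexp (2 * Real.pi * I * (((k + 1 : ℕ) : ℚ) / (m + 1 : ℕ) : ℚ)) = ζ ^ (k + 1) := by
    rw [hζ, ← Complex.exp_nat_mul]; congr 1; push_cast; ring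
  have hz' : cexp (-(2 * Real.pi * I * (((k + 1 : ℕ) : ℚ) / (m + 1 : ℕ) : ℚ))) =
      ζ⁻¹ ^ (k + 1) := by
    rw [Complex.exp_neg, hz, inv_pow]
  have e1 : ∀ n : ℕ, qpow τ (n + 0) = qpow τ 1 ^ n := fun n => by
    rw [← qpow_nat_mul]; simp
  have e2 : ∀ n : ℕ, qpow τ (n + 1 - 0) = qpow τ 1 ^ (n + 1) := fun n => by
    rw [← qpow_nat_mul]; simp
  have m1 : Multipliable fun n : ℕ => 1 - qpow τ 1 ^ n * ζ ^ (k + 1) :=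
    multipliable_one_sub_mul hq _
  have m2 : ∀ c : ℂ, Multipliable fun n : ℕ => 1 - qpow τ 1 ^ (n + 1) * c := fun c =>
    (multipliable_one_sub_mul hq (qpow τ 1 * c)).congr fun n => by ring
  have e3 : qpow τ (((0 : ℚ) ^ 2 - 0 + 1 / 6) / 2) = qpow τ (1 / 12) := by norm_num
  have e4 : (Real.pi * I * (((k + 1 : ℕ) : ℚ) / (m + 1 : ℕ) : ℚ) * ((0 : ℚ) - 1) : ℂ) =
      -(Real.pi * I * (k + 1 : ℕ) / (m + 1 : ℕ)) := by push_cast; ring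
  have h := (m1.tprod_mul (m2 (ζ⁻¹ ^ (k + 1)))).trans
    (congrArg (· * _) (tprod_eq_zero_mul' (m2 (ζ ^ (k + 1)))))
  have h' : (1 - qpow τ 1 ^ 0 * ζ ^ (k + 1)) = 1 - ζ ^ (k + 1) := by rw [pow_zero, one_mul]
  rw [h'] at h
  simp only [siegel, Matrix.cons_val_zero, Matrix.cons_val_one, hz, hz', e1, e2, e3, e4]
  rw [h]
  exact congrArg _ (mul_assoc _ _ _)

theorem prod_siegel_right (m : ℕ) (τ : UpperHalfPlane) :
    (∏ k ∈ Finset.range m, siegel ![0, ((k + 1 : ℕ) : ℚ) / (m + 1 : ℕ)] τ) ^ (12 * (m + 1)) *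
        (eulerProd (qpow τ 1) ^ 24) ^ (m + 1) =
      ((m + 1 : ℕ) : ℂ) ^ (12 * (m + 1)) * qpow τ ((m + 1 : ℕ) * m) *
        (eulerProd (qpow τ 1 ^ (m + 1)) ^ 24) ^ (m + 1) := by
  have hq := norm_qpow_lt_one τ one_pos
  have hζ := Complex.isPrimitiveRoot_exp (m + 1) (by omega)
  set ζ := cexp (2 * Real.pi * I / (m + 1 : ℕ)) with hζd
  have h1 : (∏ k ∈ Finset.range m, (1 - ζ ^ (k + 1))) = ((m + 1 : ℕ) : ℂ) := by
    simpa using hζ.prod_one_sub_pow_eq_order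
  simp only [siegel_right hζd, Finset.prod_mul_distrib]
  rw [h1]
  have t1 := tprod_root hζ hq
  have t2 := tprod_root hζ.inv hq
  have hc : (∏ k ∈ Finset.range m, (-qpow τ (1 / 12))) ^ (12 * (m + 1)) =
      qpow τ ((m + 1 : ℕ) * m) := by
    rw [Finset.prod_const, Finset.card_range, ← pow_mul, Even.neg_pow, ← qpow_nat_mul]
    · congr 1; push_cast; ring
    · exact ⟨m * 6 * (m + 1), by ring⟩
  have hc2 : (∏ k ∈ Finset.range m, cexp (-(Real.pi * I * (k + 1 : ℕ) / (m + 1 : ℕ)))) ^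
      (12 * (m + 1)) = 1 := by
    rw [← Finset.prod_pow]
    refine Finset.prod_eq_one fun k _ => ?_
    rw [← Complex.exp_nat_mul, Complex.exp_eq_one_iff]
    refine ⟨-(6 * (k + 1)), ?_⟩
    have : ((m + 1 : ℕ) : ℂ) ≠ 0 := by exact_mod_cast Nat.succ_ne_zero m
    push_cast at this ⊢
    field_simp
    ring
  generalize (∏ k ∈ Finset.range m, ∏' n : ℕ, (1 - qpow τ 1 ^ (n + 1) * ζ ^ (k + 1))) = X at *
  generalize (∏ k ∈ Finset.range m, ∏' n : ℕ, (1 - qpow τ 1 ^ (n + 1) * ζ⁻¹ ^ (k + 1))) = Y at *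
  generalize eulerProd (qpow τ 1 ^ (m + 1)) = W at *
  generalize eulerProd (qpow τ 1) = E at *
  have hW : W ^ 2 = X * Y * E ^ 2 := by rw [sq, ← t1]; nth_rewrite 2 [t1]; rw [← t2]; ring
  rw [mul_pow, mul_pow, hc, hc2, ← pow_mul, ← pow_mul,
    show 24 * (m + 1) = 2 * (12 * (m + 1)) by ring, pow_mul W, hW, pow_mul E]
  simp only [mul_pow]
  ring

theorem siegel_left (m : ℕ) (τ : UpperHalfPlane) (k j : ℕ) (hkj : k + j + 1 = m) :
    siegel ![((k + 1 : ℕ) : ℚ) / (m + 1 : ℕ), 0] τ =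
      -qpow τ (((((k + 1 : ℕ) : ℚ) / (m + 1 : ℕ)) ^ 2 - ((k + 1 : ℕ) : ℚ) / (m + 1 : ℕ)
        + 1 / 6) / 2) *
      ((∏' n : ℕ, (1 - qpow τ (1 / (m + 1 : ℕ)) ^ ((m + 1) * n + k + 1))) *
        ∏' n : ℕ, (1 - qpow τ (1 / (m + 1 : ℕ)) ^ ((m + 1) * n + j + 1))) := by
  have hp : ((m + 1 : ℕ) : ℚ) ≠ 0 := by exact_mod_cast Nat.succ_ne_zero m
  have hx := norm_qpow_lt_one τ (r := 1 / (m + 1 : ℕ)) (by positivity)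
  have hx' : ‖qpow τ (1 / (m + 1 : ℕ)) ^ (m + 1)‖ < 1 := by
    rw [norm_pow]; exact pow_lt_one₀ (norm_nonneg _) hx (by omega)
  have hm : ∀ k, Multipliable fun n : ℕ =>
      1 - qpow τ (1 / (m + 1 : ℕ)) ^ ((m + 1) * n + k + 1) := fun k => by
    refine (multipliable_one_sub_mul hx' (qpow τ (1 / (m + 1 : ℕ)) ^ (k + 1))).congr fun n => ?_
    rw [← pow_mul, ← pow_add, add_assoc]
  have e1 : ∀ n : ℕ, qpow τ (n + ((k + 1 : ℕ) : ℚ) / (m + 1 : ℕ)) =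
      qpow τ (1 / (m + 1 : ℕ)) ^ ((m + 1) * n + k + 1) := fun n => by
    rw [← qpow_nat_mul]; congr 1; field_simp; push_cast; ring
  have e2 : ∀ n : ℕ, qpow τ (n + 1 - ((k + 1 : ℕ) : ℚ) / (m + 1 : ℕ)) =
      qpow τ (1 / (m + 1 : ℕ)) ^ ((m + 1) * n + j + 1) := fun n => by
    rw [← qpow_nat_mul]; congr 1; field_simp
    rw [← hkj]; push_cast; ring
  simp only [siegel, Matrix.cons_val_zero, Matrix.cons_val_one, e1, e2]
  rw [← (hm k).tprod_mul (hm j)]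
  simp

theorem sum_bernoulli (m : ℕ) :
    ∑ k ∈ Finset.range m, (((((k + 1 : ℕ) : ℚ) / (m + 1 : ℕ)) ^ 2
      - ((k + 1 : ℕ) : ℚ) / (m + 1 : ℕ) + 1 / 6) / 2) = -(m : ℚ) / (12 * (m + 1 : ℕ)) := by
  have h1 : ∀ n : ℕ, ∑ k ∈ Finset.range n, ((k + 1 : ℕ) : ℚ) = n * (n + 1) / 2 := fun n => by
    induction n with
    | zero => simp
    | succ n ih => rw [Finset.sum_range_succ, ih]; push_cast; ring
  have h2 : ∀ n : ℕ, ∑ k ∈ Finset.range n, ((k + 1 : ℕ) : ℚ) ^ 2 =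
      n * (n + 1) * (2 * n + 1) / 6 := fun n => by
    induction n with
    | zero => simp
    | succ n ih => rw [Finset.sum_range_succ, ih]; push_cast; ring
  have hp : ((m + 1 : ℕ) : ℚ) ≠ 0 := by exact_mod_cast Nat.succ_ne_zero m
  rw [← Finset.sum_div, Finset.sum_add_distrib, Finset.sum_sub_distrib]
  simp only [div_pow]
  rw [← Finset.sum_div, ← Finset.sum_div, h1, h2]
  simp only [Finset.sum_const, Finset.card_range, nsmul_eq_mul]
  push_cast at hp ⊢
  field_simp
  ring

theorem prod_siegel_left (m : ℕ) (τ : UpperHalfPlane) :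
    (∏ k ∈ Finset.range m, siegel ![((k + 1 : ℕ) : ℚ) / (m + 1 : ℕ), 0] τ) ^ (12 * (m + 1)) *
        (eulerProd (qpow τ 1) ^ 24) ^ (m + 1) =
      qpow τ (-m) * (eulerProd (qpow τ (1 / (m + 1 : ℕ))) ^ 24) ^ (m + 1) := by
  have hp : ((m + 1 : ℕ) : ℚ) ≠ 0 := by exact_mod_cast Nat.succ_ne_zero m
  have hx := norm_qpow_lt_one τ (r := 1 / (m + 1 : ℕ)) (by positivity)
  have hx' : ‖qpow τ (1 / (m + 1 : ℕ)) ^ (m + 1)‖ < 1 := by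
    rw [norm_pow]; exact pow_lt_one₀ (norm_nonneg _) hx (by omega)
  have hq1 : qpow τ (1 / (m + 1 : ℕ)) ^ (m + 1) = qpow τ 1 := by
    rw [← qpow_nat_mul, mul_one_div_cancel hp]
  have hb := tprod_block hx m
  rw [hq1] at hb
  set t := qpow τ (1 / (m + 1 : ℕ)) with ht
  have hm : ∀ k, Multipliable fun n : ℕ => 1 - t ^ ((m + 1) * n + k + 1) := fun k => by
    refine (multipliable_one_sub_mul hx' (t ^ (k + 1))).congr fun n => ?_
    rw [← pow_mul, ← pow_add, add_assoc]
  rw [Multipliable.tprod_finsetProd fun k _ => hm k] at hb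
  have hrefl : ∏ k ∈ Finset.range m, ∏' n : ℕ, (1 - t ^ ((m + 1) * n + (m - 1 - k) + 1)) =
      ∏ k ∈ Finset.range m, ∏' n : ℕ, (1 - t ^ ((m + 1) * n + k + 1)) :=
    Finset.prod_range_reflect (fun k => ∏' n : ℕ, (1 - t ^ ((m + 1) * n + k + 1))) m
  have hprod : ∏ k ∈ Finset.range m, siegel ![((k + 1 : ℕ) : ℚ) / (m + 1 : ℕ), 0] τ =
      (-1) ^ m * qpow τ (-(m : ℚ) / (12 * (m + 1 : ℕ))) *
      (∏ k ∈ Finset.range m, ∏' n : ℕ, (1 - t ^ ((m + 1) * n + k + 1))) ^ 2 := by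
    have hs : ∀ s : Finset ℕ, ∀ f : ℕ → ℚ, ∏ k ∈ s, -qpow τ (f k) =
        (-1) ^ s.card * qpow τ (∑ k ∈ s, f k) := fun s f => by
      induction s using Finset.induction_on with
      | empty => simp [qpow]
      | insert a s ha ih =>
        rw [Finset.prod_insert ha, ih, Finset.sum_insert ha, Finset.card_insert_of_notMem ha,
          qpow_add, pow_succ]
        ring
    rw [Finset.prod_congr rfl fun k hk => siegel_left m τ k (m - 1 - k)
      (by have := Finset.mem_range.mp hk; omega)]
    rw [Finset.prod_mul_distrib, Finset.prod_mul_distrib, hrefl, hs, sum_bernoulli,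
      Finset.card_range]
    ring
  have hc : qpow τ (-(m : ℚ) / (12 * (m + 1 : ℕ))) ^ (12 * (m + 1)) = qpow τ (-m) := by
    rw [← qpow_nat_mul]
    congr 1
    push_cast at hp ⊢
    field_simp
  have hc1 : ((-1 : ℂ) ^ m) ^ (12 * (m + 1)) = 1 := by
    rw [← pow_mul]
    exact Even.neg_one_pow ⟨m * 6 * (m + 1), by ring⟩
  rw [hprod, ← hb]
  generalize (∏ k ∈ Finset.range m, ∏' n : ℕ, (1 - t ^ ((m + 1) * n + k + 1))) = X
  generalize eulerProd (qpow τ 1) = E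
  rw [mul_pow, mul_pow, hc, hc1, ← pow_mul, ← pow_mul, ← pow_mul,
    show 24 * (m + 1) = 2 * (12 * (m + 1)) by ring, mul_pow]
  ring

/-- For `a ∈ (p⁻¹ℤ/ℤ)²`, written as `(a₁, a₂) / p` with `a₁, a₂ ∈ 𝔽_p`, the function
`u_a = g_a^{12p}`. It does not depend on the lift of `a` to `ℚ²`; the lift with coordinates
in `[0, 1)` is used. -/
def u (p : ℕ) (a : Fin 2 → ZMod p) (τ : UpperHalfPlane) : ℂ :=
  siegel (fun i => ((a i).val : ℚ) / p) τ ^ (12 * p)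

/-- The `G`-invariant set `A = {(a, 0) : a ≠ 0} ∪ {(0, a) : a ≠ 0}`. -/
def A (p : ℕ) [NeZero p] : Finset (Fin 2 → ZMod p) :=
  (Finset.univ.filter fun a : ZMod p => a ≠ 0).image (fun a => ![a, 0]) ∪
    (Finset.univ.filter fun a : ZMod p => a ≠ 0).image (fun a => ![0, a])

/-- The modular unit `U = ∏_{a ∈ A} u_a`, as a function on the upper half-plane. -/
def U (p : ℕ) [NeZero p] (τ : UpperHalfPlane) : ℂ :=
  ∏ a ∈ A p, u p a τ

theorem prod_ne_zero_eq (m : ℕ) (f : ℕ → ℂ) :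
    ∏ a : ZMod (m + 1) with a ≠ 0, f a.val = ∏ k ∈ Finset.range m, f (k + 1) := by
  symm
  refine Finset.prod_bij (fun k _ => ((k + 1 : ℕ) : ZMod (m + 1))) ?_ ?_ ?_ ?_
  · intro k hk
    have hk := Finset.mem_range.mp hk
    simp only [Finset.mem_filter, Finset.mem_univ, true_and]
    intro h
    have := Nat.le_of_dvd (by omega) ((ZMod.natCast_eq_zero_iff _ _).mp h)
    omega
  · intro k hk l hl h
    have hk := Finset.mem_range.mp hk
    have hl := Finset.mem_range.mp hl
    have h' := congrArg ZMod.val h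
    rw [ZMod.val_natCast_of_lt (by omega), ZMod.val_natCast_of_lt (by omega)] at h'
    omega
  · intro a ha
    have ha : a ≠ 0 := by simpa using ha
    have h0 : a.val ≠ 0 := by simpa using ha
    have h1 := ZMod.val_lt a
    refine ⟨a.val - 1, Finset.mem_range.mpr (by omega), ?_⟩
    rw [Nat.sub_add_cancel (by omega), ZMod.natCast_zmod_val]
  · intro k hk
    have hk := Finset.mem_range.mp hk
    rw [ZMod.val_natCast_of_lt (by omega)]

theorem U_eq_prod (m : ℕ) (τ : UpperHalfPlane) :
    U (m + 1) τ =
      (∏ k ∈ Finset.range m, siegel ![((k + 1 : ℕ) : ℚ) / (m + 1 : ℕ), 0] τ) ^ (12 * (m + 1)) *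
      (∏ k ∈ Finset.range m, siegel ![0, ((k + 1 : ℕ) : ℚ) / (m + 1 : ℕ)] τ) ^
        (12 * (m + 1)) := by
  have hv1 : ∀ a : ZMod (m + 1), (fun i => (((![a, 0] : Fin 2 → ZMod (m + 1)) i).val : ℚ) /
      (m + 1 : ℕ)) = ![(a.val : ℚ) / (m + 1 : ℕ), 0] := fun a => by
    funext i; fin_cases i <;> simp
  have hv2 : ∀ a : ZMod (m + 1), (fun i => (((![0, a] : Fin 2 → ZMod (m + 1)) i).val : ℚ) /
      (m + 1 : ℕ)) = ![0, (a.val : ℚ) / (m + 1 : ℕ)] := fun a => by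
    funext i; fin_cases i <;> simp
  rw [U, A, Finset.prod_union, Finset.prod_image, Finset.prod_image]
  · simp only [u, hv1, hv2, Finset.prod_pow]
    rw [prod_ne_zero_eq m fun k => siegel ![(k : ℚ) / (m + 1 : ℕ), 0] τ,
      prod_ne_zero_eq m fun k => siegel ![0, (k : ℚ) / (m + 1 : ℕ)] τ]
  · intro a _ b _ h
    simpa using congrFun h 1
  · intro a _ b _ h
    simpa using congrFun h 0
  · rw [Finset.disjoint_left]
    intro v hv hw
    simp only [Finset.mem_image, Finset.mem_filter, Finset.mem_univ, true_and] at hv hw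
    obtain ⟨a, ha, rfl⟩ := hv
    obtain ⟨b, hb, h⟩ := hw
    exact ha (by simpa using (congrFun h 0).symm)

/-- `U(τ) = p^{12p} (Δ(pτ) Δ(τ/p) / Δ(τ)²)^p`, where `Δ = η²⁴`. -/
theorem U_eq (p : ℕ) [NeZero p] (τ : UpperHalfPlane) :
    U p τ * (ModularForm.eta τ ^ 24) ^ (2 * p) =
      (p : ℂ) ^ (12 * p) *
        (ModularForm.eta (p * τ) ^ 24 * ModularForm.eta (τ / p) ^ 24) ^ p := by
  obtain ⟨m, rfl⟩ : ∃ m, p = m + 1 := Nat.exists_eq_succ_of_ne_zero (NeZero.ne p)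
  have hp : ((m + 1 : ℕ) : ℚ) ≠ 0 := by exact_mod_cast Nat.succ_ne_zero m
  have hL := prod_siegel_left m τ
  have hR := prod_siegel_right m τ
  have e1 : cexp (2 * Real.pi * I * τ) = qpow τ 1 := by simp [qpow]
  have e2 : cexp (2 * Real.pi * I * ((m + 1 : ℕ) * τ)) = qpow τ 1 ^ (m + 1) := by
    rw [qpow, ← Complex.exp_nat_mul]; congr 1; push_cast; ring
  have e3 : cexp (2 * Real.pi * I * (τ / (m + 1 : ℕ))) = qpow τ (1 / (m + 1 : ℕ)) := by
    rw [qpow]; congr 1; push_cast; ring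
  have e4 : qpow τ (-m) * qpow τ ((m + 1 : ℕ) * m) * qpow τ 1 ^ (2 * (m + 1)) =
      (qpow τ 1 ^ (m + 1) * qpow τ (1 / (m + 1 : ℕ))) ^ (m + 1) := by
    rw [← qpow_nat_mul, ← qpow_nat_mul, ← qpow_add, ← qpow_add, ← qpow_add, ← qpow_nat_mul]
    congr 1
    push_cast at hp ⊢
    field_simp
    ring
  rw [U_eq_prod, eta_pow_eq, eta_pow_eq, eta_pow_eq, e1, e2, e3]
  generalize (∏ k ∈ Finset.range m, siegel ![((k + 1 : ℕ) : ℚ) / (m + 1 : ℕ), 0] τ) ^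
    (12 * (m + 1)) = X at *
  generalize (∏ k ∈ Finset.range m, siegel ![0, ((k + 1 : ℕ) : ℚ) / (m + 1 : ℕ)] τ) ^
    (12 * (m + 1)) = Z at *
  generalize eulerProd (qpow τ 1 ^ (m + 1)) ^ 24 = W at *
  generalize eulerProd (qpow τ 1) ^ 24 = E at *
  generalize eulerProd (qpow τ (1 / (m + 1 : ℕ))) ^ 24 = T at *
  have e5 : (E : ℂ) ^ (2 * (m + 1)) = E ^ (m + 1) * E ^ (m + 1) := by rw [two_mul, pow_add]
  calc X * Z * (qpow τ 1 * E) ^ (2 * (m + 1))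
      = (X * E ^ (m + 1)) * (Z * E ^ (m + 1)) * qpow τ 1 ^ (2 * (m + 1)) := by
        rw [mul_pow, e5]; ring
    _ = ((m + 1 : ℕ) : ℂ) ^ (12 * (m + 1)) * (W ^ (m + 1) * T ^ (m + 1)) *
        (qpow τ (-m) * qpow τ ((m + 1 : ℕ) * m) * qpow τ 1 ^ (2 * (m + 1))) := by
        rw [hL, hR]; ring
    _ = _ := by rw [e4, mul_pow, mul_pow, mul_pow, mul_pow]; ring

theorem denom_ne_zero (γ : SL(2, ℤ)) (τ : UpperHalfPlane) :
    ((γ 1 0 : ℂ) * τ + γ 1 1) ≠ 0 := by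
  simpa [UpperHalfPlane.denom] using
    UpperHalfPlane.denom_ne_zero (Matrix.SpecialLinearGroup.mapGL ℝ γ) τ

theorem eta_moebius {a b c d : ℤ} (hdet : a * d - b * c = 1) {z w : ℂ} (hz : 0 < z.im)
    (hw : w * (c * z + d) = a * z + b) :
    ModularForm.eta w ^ 24 = (c * z + d) ^ 12 * ModularForm.eta z ^ 24 := by
  let γ : SL(2, ℤ) := ⟨!![a, b; c, d], by rw [Matrix.det_fin_two_of, hdet]⟩
  have h := discriminant_smul γ ⟨z, hz⟩
  have h0 : (c * z + d : ℂ) ≠ 0 := by simpa [γ] using denom_ne_zero γ ⟨z, hz⟩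
  have hw' : ((γ • (⟨z, hz⟩ : UpperHalfPlane) : UpperHalfPlane) : ℂ) = w := by
    rw [eq_div_of_mul_eq h0 hw, UpperHalfPlane.specialLinearGroup_apply]
    simp [γ]
  rw [ModularForm.discriminant, ModularForm.discriminant, hw'] at h
  simpa [γ] using h

/-- `U` is invariant under `Γ`. -/
theorem U_smul {p : ℕ} [Fact p.Prime] (hp : 3 ≤ p) {γ : SL(2, ℤ)} (hγ : γ ∈ Γ p)
    (τ : UpperHalfPlane) : U p (γ • τ) = U p τ := by
  have hp0 : (p : ℂ) ≠ 0 := by exact_mod_cast (NeZero.ne p)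
  have hpR : (0 : ℝ) < p := by exact_mod_cast (show 0 < p by omega)
  have hpZ : (p : ℤ) ≠ 0 := by exact_mod_cast (NeZero.ne p)
  have hdet : γ 0 0 * γ 1 1 - γ 0 1 * γ 1 0 = 1 := by
    have := γ.det_coe
    rwa [Matrix.det_fin_two] at this
  have h0 := denom_ne_zero γ τ
  have hw : ((γ • τ : UpperHalfPlane) : ℂ) * ((γ 1 0 : ℂ) * τ + γ 1 1) =
      (γ 0 0 : ℂ) * τ + γ 0 1 := by
    rw [UpperHalfPlane.specialLinearGroup_apply]
    simp [div_mul_cancel₀ _ h0]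
  have him1 : 0 < ((p : ℂ) * τ).im := by
    rw [← Complex.ofReal_natCast, Complex.im_ofReal_mul]; exact mul_pos hpR τ.im_pos
  have him2 : 0 < ((τ : ℂ) / p).im := by
    rw [← Complex.ofReal_natCast, Complex.div_ofReal_im]; exact div_pos τ.im_pos hpR
  have h1 := eta_moebius hdet τ.im_pos hw
  have key : ModularForm.eta (p * (γ • τ : UpperHalfPlane)) ^ 24 *
      ModularForm.eta ((γ • τ : UpperHalfPlane) / p) ^ 24 =
      ((γ 1 0 : ℂ) * τ + γ 1 1) ^ 24 *
        (ModularForm.eta (p * τ) ^ 24 * ModularForm.eta (τ / p) ^ 24) := by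
    have hent := entries_of_mem_Γ hp hγ
    clear h1 hγ
    generalize ((γ • τ : UpperHalfPlane) : ℂ) = w at *
    generalize (τ : ℂ) = z at *
    generalize γ 0 0 = a at *
    generalize γ 0 1 = b at *
    generalize γ 1 0 = c at *
    generalize γ 1 1 = d at *
    rcases hent with ⟨⟨b, rfl⟩, ⟨c, rfl⟩⟩ | ⟨⟨a, rfl⟩, ⟨d, rfl⟩⟩
    · have k1 := eta_moebius (a := a) (b := p * (p * b)) (c := c) (d := d)
        (by linear_combination hdet) him1 (w := p * w) (by
          push_cast at hw ⊢; linear_combination (p : ℂ) * hw)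
      have k2 := eta_moebius (a := a) (b := b) (c := p * (p * c)) (d := d)
        (by linear_combination hdet) him2 (w := w / p) (by
          push_cast at hw ⊢; field_simp; linear_combination hw)
      have j1 : ((c : ℤ) : ℂ) * (p * z) + d = ((p * c : ℤ) : ℂ) * z + d := by push_cast; ring
      have j2 : ((p * (p * c) : ℤ) : ℂ) * (z / p) + d = ((p * c : ℤ) : ℂ) * z + d := by
        push_cast; field_simp
      rw [k1, k2, j1, j2]
      ring
    · have k1 := eta_moebius (a := p * (p * a)) (b := b) (c := c) (d := d)
        (by linear_combination hdet) him2 (w := p * w) (by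
          push_cast at hw ⊢; field_simp; linear_combination hw)
      have k2 := eta_moebius (a := a) (b := b) (c := c) (d := p * (p * d))
        (by linear_combination hdet) him1 (w := w / p) (by
          push_cast at hw ⊢; field_simp; linear_combination hw)
      have j1 : (c : ℂ) * (z / p) + d = ((c : ℂ) * z + ((p * d : ℤ) : ℂ)) / p := by
        push_cast; field_simp
      have j2 : (c : ℂ) * (p * z) + ((p * (p * d) : ℤ) : ℂ) =
          ((c : ℂ) * z + ((p * d : ℤ) : ℂ)) * p := by
        push_cast; ring
      rw [k1, k2, j1, j2, div_pow, mul_pow]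
      field_simp
  have hU := U_eq p (γ • τ)
  rw [key, h1] at hU
  have hU' := U_eq p τ
  have hne : (ModularForm.eta τ ^ 24) ^ (2 * p) ≠ 0 :=
    pow_ne_zero _ (pow_ne_zero _ (ModularForm.eta_ne_zero τ.im_pos))
  generalize ((γ 1 0 : ℂ) * τ + γ 1 1) = J at *
  have hJ : J ^ (24 * p) ≠ 0 := pow_ne_zero _ h0
  have e1 : (J ^ 12) ^ (2 * p) = J ^ (24 * p) := by rw [← pow_mul]; congr 1; ring
  have e2 : (J ^ 24) ^ p = J ^ (24 * p) := by rw [← pow_mul]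
  rw [mul_pow, mul_pow (J ^ 24), e1, e2] at hU
  apply mul_right_cancel₀ (mul_ne_zero hJ hne)
  linear_combination hU - J ^ (24 * p) * hU'

/-- The modular invariant as a function on `Y_G(ℂ)`. -/
def jY {p : ℕ} : Y p → ℂ :=
  Quotient.lift jInv fun a b h => by
    obtain ⟨γ, rfl⟩ := MulAction.orbitRel_apply.mp h
    exact jInv_smul γ b

/-- The modular unit `U` as a function on `Y_G(ℂ)`. -/
def UY {p : ℕ} [Fact p.Prime] (hp : 3 ≤ p) : Y p → ℂ :=
  Quotient.lift (U p) fun a b h => by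
    obtain ⟨γ, rfl⟩ := MulAction.orbitRel_apply.mp h
    exact U_smul hp γ.2 b

end SplitCartan

end

/-! Put φ(w) = log(|Δ(w)| (Im w)⁶), which is invariant under SL₂(ℤ). The product formula for U gives
log|U(τ)| = 12p log p + p(φ(pτ) + φ(τ/p) − 2φ(τ)), the powers of Im τ cancelling (`log_norm_U`).
Write τ = γz with z in the fundamental domain and y = Im z. Then φ(τ) = φ(z) = −2πy + 6 log y + O(1)
and log|j(τ)| ≤ 2πy + O(1), so the first alternative holds when y ≤ √p + (3/π) log p.

For larger y, `logPetersson_hecke` replaces pτ and τ/p by points of the Hecke orbit of z: either pz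
and one (z + k)/p, or two points (z + k)/p. In the first case φ(pz) ≈ −2πpy dominates, log|U| is
about −2π(p − 1)²y, and division by 2(p − 1) leaves enough to cover 2πy, even for p = 3
(`cusp_estimate`). In the second case with y ≤ p, φ((z + k)/p) ≥ −2πp/y − O(1), so log|U| ≥ p(4πy −
4πp/y − O(1)). Since p/(√p + t) = √p − t + O(1) for t = (3/π) log p, this yields 2πy ≤ log|U|/(2(p −
1)) + 2π√p − 6 log p + O(1). For y ≥ p the expansion at the cusp applies directly to (z + k)/p
(`noncusp_estimate`). -/

namespace SplitCartan

open Complex ModularGroup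
open scoped MatrixGroups

/-! ### Invariance of the Petersson norm of Δ -/

/-- The logarithm of the Petersson norm `|Δ(w)| (Im w)⁶`, where `Δ = η²⁴`. -/
noncomputable def logPetersson (w : ℂ) : ℝ :=
  Real.log ‖ModularForm.eta w ^ 24‖ + 6 * Real.log w.im

theorem im_moebius {a b c d : ℤ} (hdet : a * d - b * c = 1) {z w : ℂ}
    (hw : w * (c * z + d) = a * z + b) : w.im * normSq (c * z + d) = z.im := by
  -- Multiplying the relation by the conjugate of cz + d avoids dividing by cz + d, not yet known to
  -- be nonzero.
  have h : w * (normSq (c * z + d) : ℂ) = (a * z + b) * starRingEnd ℂ (c * z + d) := by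
    rw [← hw, normSq_eq_conj_mul_self]; ring
  have h' := congrArg Complex.im h
  have hdet' : (a * d - b * c : ℝ) = 1 := by exact_mod_cast hdet
  rw [Complex.im_mul_ofReal] at h'
  rw [h']
  simp
  linear_combination z.im * hdet'

theorem normSq_moebius_pos {a b c d : ℤ} (hdet : a * d - b * c = 1) {z w : ℂ} (hz : 0 < z.im)
    (hw : w * (c * z + d) = a * z + b) : 0 < normSq (c * z + d) := by
  refine (normSq_nonneg _).lt_of_ne fun h => ?_
  have := im_moebius hdet hw
  rw [← h, mul_zero] at this
  exact hz.ne this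

theorem im_moebius_pos {a b c d : ℤ} (hdet : a * d - b * c = 1) {z w : ℂ} (hz : 0 < z.im)
    (hw : w * (c * z + d) = a * z + b) : 0 < w.im :=
  pos_of_mul_pos_left ((im_moebius hdet hw).symm ▸ hz) (normSq_nonneg _)

/-- The Petersson norm of `Δ` is invariant under `SL₂(ℤ)`. -/
theorem logPetersson_moebius {a b c d : ℤ} (hdet : a * d - b * c = 1) {z w : ℂ} (hz : 0 < z.im)
    (hw : w * (c * z + d) = a * z + b) : logPetersson w = logPetersson z := by
  have hn := normSq_moebius_pos hdet hz hw
  have hwi := im_moebius_pos hdet hz hw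
  have heta : ‖ModularForm.eta z ^ 24‖ ≠ 0 :=
    norm_ne_zero_iff.mpr (pow_ne_zero _ (ModularForm.eta_ne_zero hz))
  have hJ : ‖(c * z + d : ℂ) ^ 12‖ = normSq (c * z + d) ^ 6 := by
    rw [norm_pow, normSq_eq_norm_sq, ← pow_mul]
  rw [logPetersson, logPetersson, eta_moebius hdet hz hw, norm_mul, hJ, ← im_moebius hdet hw,
    Real.log_mul (pow_pos hn 6).ne' heta, Real.log_mul hwi.ne' hn.ne', Real.log_pow]
  push_cast
  ring

/-- A point of the upper half-plane is equivalent under `SL₂(ℤ)` to a point `z` of the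
fundamental domain. -/
theorem exists_moebius_fd (τ : UpperHalfPlane) :
    ∃ (z : UpperHalfPlane) (γ : SL(2, ℤ)), z ∈ fd ∧ γ • z = τ := by
  obtain ⟨γ, hγ⟩ := exists_smul_mem_fd τ
  exact ⟨γ • τ, γ⁻¹, hγ, inv_smul_smul γ τ⟩

theorem one_half_le_im_of_mem_fd {z : UpperHalfPlane} (hz : z ∈ fd) : 1 / 2 ≤ z.im := by
  nlinarith [three_le_four_mul_im_sq_of_mem_fd hz, z.im_pos]

theorem coe_smul_mul (γ : SL(2, ℤ)) (τ : UpperHalfPlane) :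
    ((γ • τ : UpperHalfPlane) : ℂ) * ((γ 1 0 : ℂ) * τ + γ 1 1) = (γ 0 0 : ℂ) * τ + γ 0 1 := by
  rw [UpperHalfPlane.specialLinearGroup_apply]
  simp [div_mul_cancel₀ _ (denom_ne_zero γ τ)]

theorem det_entries (γ : SL(2, ℤ)) : γ 0 0 * γ 1 1 - γ 0 1 * γ 1 0 = 1 := by
  have := γ.det_coe
  rwa [Matrix.det_fin_two] at this

/-! ### Size of Δ and of its Petersson norm -/

/-- The Euler product is continuous and has no zero on this compact disc. The radius e^(−π) is the
value of |q| at Im w = 1/2, a height below the whole fundamental domain. -/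
theorem exists_log_eulerProd_bound :
    ∃ K : ℝ, ∀ x : ℂ, ‖x‖ ≤ Real.exp (-Real.pi) → |24 * Real.log ‖eulerProd x‖| ≤ K := by
  have hr : Real.exp (-Real.pi) < 1 := Real.exp_lt_one_iff.mpr (neg_lt_zero.mpr Real.pi_pos)
  have hsub : Metric.closedBall (0 : ℂ) (Real.exp (-Real.pi)) ⊆ Metric.ball 0 1 :=
    Metric.closedBall_subset_ball hr
  have hc : ContinuousOn (fun x => 24 * Real.log ‖eulerProd x‖)
      (Metric.closedBall (0 : ℂ) (Real.exp (-Real.pi))) := by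
    refine continuousOn_const.mul (ContinuousOn.log ?_ fun x hx => ?_)
    · exact (ModularForm.differentiableOn_tprod_one_sub_pow.continuousOn.mono hsub).norm
    · exact norm_ne_zero_iff.mpr (eulerProd_ne_zero (by simpa using hsub hx))
  obtain ⟨K, hK⟩ := (isCompact_closedBall (0 : ℂ) _).exists_bound_of_continuousOn hc
  exact ⟨K, fun x hx => hK x (by simpa using hx)⟩

theorem log_norm_eta_pow {w : ℂ} (hw : 0 < w.im) :
    Real.log ‖ModularForm.eta w ^ 24‖ = -(2 * Real.pi * w.im) +
      24 * Real.log ‖eulerProd (cexp (2 * Real.pi * I * w))‖ := by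
  have hre : (2 * Real.pi * I * w : ℂ).re = -(2 * Real.pi * w.im) := by simp
  have hx : ‖cexp (2 * Real.pi * I * w)‖ < 1 := by
    rw [Complex.norm_exp, hre, Real.exp_lt_one_iff]
    have := mul_pos Real.two_pi_pos hw
    linarith
  rw [eta_pow_eq, norm_mul, Complex.norm_exp, hre, norm_pow, Real.log_mul (Real.exp_ne_zero _)
    (pow_ne_zero _ (norm_ne_zero_iff.mpr (eulerProd_ne_zero hx))), Real.log_exp, Real.log_pow]
  norm_num

/-- `log |Δ(w)| = -2π Im w + O(1)` for `Im w ≥ 1/2`. -/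
theorem exists_log_norm_eta_bound :
    ∃ K : ℝ, ∀ w : ℂ, 1 / 2 ≤ w.im →
      |Real.log ‖ModularForm.eta w ^ 24‖ + 2 * Real.pi * w.im| ≤ K := by
  obtain ⟨K, hK⟩ := exists_log_eulerProd_bound
  refine ⟨K, fun w hw => ?_⟩
  rw [log_norm_eta_pow (by linarith), neg_add_eq_sub, sub_add_cancel]
  refine hK _ ?_
  rw [Complex.norm_exp, Real.exp_le_exp]
  have hre : (2 * Real.pi * I * w : ℂ).re = -(2 * Real.pi * w.im) := by simp
  rw [hre]
  nlinarith [Real.pi_pos]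

theorem exists_logPetersson_bound :
    ∃ K : ℝ, ∀ w : ℂ, 1 / 2 ≤ w.im →
      |logPetersson w + 2 * Real.pi * w.im - 6 * Real.log w.im| ≤ K := by
  obtain ⟨K, hK⟩ := exists_log_norm_eta_bound
  refine ⟨K, fun w hw => ?_⟩
  convert hK w hw using 2
  rw [logPetersson]
  ring

/-- By invariance w may be moved to the fundamental domain, where −2πy + 6 log y is bounded above
because log y ≤ y − 1 and π > 3. -/
theorem exists_logPetersson_le : ∃ K : ℝ, ∀ w : ℂ, 0 < w.im → logPetersson w ≤ K := by
  obtain ⟨K, hK⟩ := exists_logPetersson_bound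
  refine ⟨K, fun w hw => ?_⟩
  obtain ⟨z, γ, hz, hγ⟩ := exists_moebius_fd ⟨w, hw⟩
  have h2 := one_half_le_im_of_mem_fd hz
  have h1 := coe_smul_mul γ z
  rw [hγ] at h1
  rw [logPetersson_moebius (det_entries γ) z.im_pos h1]
  have h3 := (abs_le.mp (hK z h2)).2
  have h4 := Real.log_le_sub_one_of_pos z.im_pos
  have h5 := mul_le_mul_of_nonneg_right Real.pi_gt_three.le z.im_pos.le
  simp only [UpperHalfPlane.coe_im] at h3
  linarith

/-- The representative of w in the fundamental domain has height at most 1/Im w, and there the norm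
is at least −2πy − O(1). -/
theorem exists_le_logPetersson :
    ∃ K : ℝ, ∀ w : ℂ, 0 < w.im → w.im ≤ 1 → -(2 * Real.pi / w.im) - K ≤ logPetersson w := by
  obtain ⟨K, hK⟩ := exists_logPetersson_bound
  refine ⟨K + 6 * Real.log 2, fun w hw hw1 => ?_⟩
  obtain ⟨γ, hz⟩ := exists_smul_mem_fd ⟨w, hw⟩
  have h1 := coe_smul_mul γ ⟨w, hw⟩
  have h2 := one_half_le_im_of_mem_fd hz
  have him := im_moebius (det_entries γ) h1
  have hpet := logPetersson_moebius (det_entries γ) hw h1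
  generalize γ • (⟨w, hw⟩ : UpperHalfPlane) = z at *
  -- Here Im z = Im w/|cw + d|², and |cw + d|² ≥ (Im w)²: if c ≠ 0 from the imaginary part of cw +
  -- d, and if c = 0 from d² ≥ 1 ≥ (Im w)².
  have hle : z.im ≤ 1 / w.im := by
    rw [le_div_iff₀ hw]
    simp only [UpperHalfPlane.coe_im] at him
    have hn : normSq ((γ 1 0 : ℂ) * w + γ 1 1) =
        (γ 1 0 * w.re + γ 1 1 : ℝ) ^ 2 + (γ 1 0 * w.im : ℝ) ^ 2 := by
      simp [normSq_apply]; ring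
    rw [hn] at him
    have hz0 := z.im_pos
    by_cases hc : γ 1 0 = 0
    · have hd : γ 1 1 ≠ 0 := fun h => by simpa [hc, h] using det_entries γ
      have hd1 : (1 : ℝ) ≤ (γ 1 1 : ℝ) ^ 2 := by
        exact_mod_cast (show 0 < γ 1 1 ^ 2 by positivity)
      simp only [hc, Int.cast_zero, zero_mul, zero_add] at him
      nlinarith
    · have hc1 : (1 : ℝ) ≤ (γ 1 0 : ℝ) ^ 2 := by
        exact_mod_cast (show 0 < γ 1 0 ^ 2 by positivity)
      have k1 : z.im * w.im ^ 2 ≤ z.im * ((γ 1 0 * w.re + γ 1 1 : ℝ) ^ 2 + (γ 1 0 * w.im : ℝ) ^ 2) := by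
        refine mul_le_mul_of_nonneg_left ?_ hz0.le
        nlinarith [sq_nonneg (γ 1 0 * w.re + γ 1 1 : ℝ), sq_nonneg w.im]
      rw [him] at k1
      have k2 : w.im * (z.im * w.im) ≤ w.im * 1 := by linarith
      exact le_of_mul_le_mul_left k2 hw
  have h3 := (abs_le.mp (hK z h2)).1
  simp only [UpperHalfPlane.coe_im] at h3
  have h4 : -Real.log 2 ≤ Real.log z.im := by
    rw [← Real.log_inv]; exact Real.log_le_log (by norm_num) (by linarith)
  have h5 := mul_le_mul_of_nonneg_left hle Real.two_pi_pos.le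
  have h6 : 2 * Real.pi * (1 / w.im) = 2 * Real.pi / w.im := by ring
  rw [← hpet]
  linarith

/-! ### Growth of j on the fundamental domain -/

/-- The Eisenstein series `E₄` is bounded on the fundamental domain. -/
theorem exists_norm_E₄_le : ∃ M : ℝ, ∀ z ∈ fd, ‖ModularForm.E₄ z‖ ≤ M := by
  obtain ⟨M, A, hM⟩ := UpperHalfPlane.isBoundedAtImInfty_iff.mp
    (ModularFormClass.bdd_at_infty ModularForm.E₄)
  obtain ⟨N, hN⟩ := (isCompact_truncatedFundamentalDomain A).exists_bound_of_continuousOn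
    (ModularFormClass.holo ModularForm.E₄).continuous.continuousOn
  refine ⟨max M N, fun z hz => ?_⟩
  rcases le_total A z.im with h | h
  · exact (hM z h).trans (le_max_left _ _)
  · exact (hN z ⟨hz, h⟩).trans (le_max_right _ _)

/-- `log |j(z)| ≤ 2π Im z + O(1)` on the fundamental domain. -/
theorem exists_log_norm_jInv_le :
    ∃ K : ℝ, ∀ z ∈ fd, Real.log ‖jInv z‖ ≤ 2 * Real.pi * z.im + K := by
  obtain ⟨M, hM⟩ := exists_norm_E₄_le
  obtain ⟨K, hK⟩ := exists_log_norm_eta_bound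
  refine ⟨|3 * Real.log M| + |K|, fun z hz => ?_⟩
  have hz' := one_half_le_im_of_mem_fd hz
  have h1 := (abs_le.mp (hK z hz')).1
  simp only [UpperHalfPlane.coe_im] at h1
  have hpos := mul_pos Real.two_pi_pos z.im_pos
  -- At a zero of j the convention log 0 = 0 applies, so the bound has to be nonnegative; the
  -- absolute values in the constant ensure this.
  by_cases h0 : ModularForm.E₄ z = 0
  · simp only [jInv, h0]
    simp
    positivity
  · have h0' := norm_pos_iff.mpr h0
    have hD : ‖ModularForm.eta z ^ 24‖ ≠ 0 :=
      norm_ne_zero_iff.mpr (pow_ne_zero _ (ModularForm.eta_ne_zero z.im_pos))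
    have h2 := Real.log_le_log h0' (hM z hz)
    rw [jInv, ModularForm.discriminant, norm_div, Real.log_div (by simpa using h0) hD, norm_pow,
      Real.log_pow]
    have h3 := le_abs_self (3 * Real.log M)
    have h4 := le_abs_self K
    push_cast
    linarith

/-! ### The unit U and the Hecke orbit of z -/

/-- This is the logarithm of `U_eq`; the terms in Im τ drop out because (p · Im τ)(Im τ/p) = (Im
τ)². -/
theorem log_norm_U (p : ℕ) [NeZero p] (τ : UpperHalfPlane) :
    Real.log ‖U p τ‖ = 12 * p * Real.log p +
      p * (logPetersson (p * τ) + logPetersson (τ / p) - 2 * logPetersson τ) := by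
  have hpR : (0 : ℝ) < p := by exact_mod_cast NeZero.pos p
  have hne : ∀ w : ℂ, 0 < w.im → ModularForm.eta w ^ 24 ≠ 0 := fun w hw =>
    pow_ne_zero _ (ModularForm.eta_ne_zero hw)
  have i1 : ((p : ℂ) * τ).im = p * τ.im := by
    rw [← Complex.ofReal_natCast, Complex.im_ofReal_mul]; rfl
  have i2 : ((τ : ℂ) / p).im = τ.im / p := by
    rw [← Complex.ofReal_natCast, Complex.div_ofReal_im]; rfl
  have n0 := hne τ τ.im_pos
  have n1 := hne (p * τ) (i1 ▸ mul_pos hpR τ.im_pos)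
  have n2 := hne (τ / p) (i2 ▸ div_pos τ.im_pos hpR)
  have hpC : (p : ℂ) ≠ 0 := by exact_mod_cast NeZero.ne p
  have hU := U_eq p τ
  have hU0 : U p τ ≠ 0 := fun h => by
    rw [h, zero_mul] at hU
    exact mul_ne_zero (pow_ne_zero _ hpC) (pow_ne_zero _ (mul_ne_zero n1 n2)) hU.symm
  rw [logPetersson, logPetersson, logPetersson, i1, i2, UpperHalfPlane.coe_im,
    Real.log_mul hpR.ne' τ.im_pos.ne', Real.log_div τ.im_pos.ne' hpR.ne']
  generalize ModularForm.eta (p * τ) ^ 24 = X at *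
  generalize ModularForm.eta (τ / p) ^ 24 = Y at *
  generalize ModularForm.eta τ ^ 24 = Z at *
  have h := congrArg (fun x : ℂ => Real.log ‖x‖) hU
  simp only [norm_mul, norm_pow] at h
  have a1 := norm_ne_zero_iff.mpr n0
  have a2 := norm_ne_zero_iff.mpr n1
  have a3 := norm_ne_zero_iff.mpr n2
  have a4 := norm_ne_zero_iff.mpr hU0
  have a5 := norm_ne_zero_iff.mpr hpC
  rw [Real.log_mul a4 (pow_ne_zero _ a1), Real.log_mul (pow_ne_zero _ a5)
    (pow_ne_zero _ (mul_ne_zero a2 a3)), Real.log_pow, Real.log_pow, Real.log_pow,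
    Real.log_mul a2 a3, Complex.norm_natCast] at h
  push_cast at h
  linear_combination h

theorem exists_int_mul_congr {p : ℕ} [Fact p.Prime] {c : ℤ} (hc : ¬(p : ℤ) ∣ c) (d : ℤ) :
    ∃ k e : ℤ, d = c * k + p * e := by
  have hcop : IsCoprime c (p : ℤ) :=
    ((Nat.prime_iff_prime_int.mp Fact.out).coprime_iff_not_dvd.mpr hc).symm
  obtain ⟨u, v, h⟩ := hcop
  exact ⟨u * d, v * d, by linear_combination -d * h⟩

/-- For `τ = γ z`, the values of the Petersson norm of `Δ` at `pτ` and `τ/p` are values at points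
`pz` and `(z + k)/p` with an integer `k`; the point `pz` occurs at most once. -/
theorem logPetersson_hecke {p : ℕ} [Fact p.Prime] (γ : SL(2, ℤ)) (z : UpperHalfPlane) :
    (∃ k : ℤ, logPetersson (p * (γ • z : UpperHalfPlane)) +
        logPetersson ((γ • z : UpperHalfPlane) / p) =
      logPetersson (p * z) + logPetersson ((z + k) / p)) ∨
    ∃ k l : ℤ, logPetersson (p * (γ • z : UpperHalfPlane)) +
        logPetersson ((γ • z : UpperHalfPlane) / p) =
      logPetersson ((z + k) / p) + logPetersson ((z + l) / p) := by
  have hpR : (0 : ℝ) < p := by exact_mod_cast (Fact.out : p.Prime).pos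
  have hp0 : (p : ℂ) ≠ 0 := by exact_mod_cast (Fact.out : p.Prime).ne_zero
  have hw := coe_smul_mul γ z
  have hdet := det_entries γ
  have him1 : 0 < ((p : ℂ) * z).im := by
    rw [← Complex.ofReal_natCast, Complex.im_ofReal_mul]; exact mul_pos hpR z.im_pos
  have him2 : ∀ k : ℤ, 0 < (((z : ℂ) + k) / p).im := fun k => by
    rw [← Complex.ofReal_natCast, Complex.div_ofReal_im]
    exact div_pos (by simpa using z.im_pos) hpR
  generalize ((γ • z : UpperHalfPlane) : ℂ) = w at *
  generalize (z : ℂ) = z at *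
  generalize γ 0 0 = a at *
  generalize γ 0 1 = b at *
  generalize γ 1 0 = c at *
  generalize γ 1 1 = d at *
  have c1 : (p : ℤ) ∣ c → logPetersson (p * w) = logPetersson (p * z) := by
    rintro ⟨c, rfl⟩
    refine logPetersson_moebius (a := a) (b := p * b) (c := c) (d := d)
      (by linear_combination hdet) him1 ?_
    push_cast at hw ⊢
    linear_combination (p : ℂ) * hw
  -- With ck ≡ d mod p, the matrix diag(p, 1)γ factors as an element of SL₂(ℤ) times (1 k; 0 p). The
  -- case of w/p is the same with diag(1, p)γ and ak ≡ b mod p.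
  have c2 : ¬(p : ℤ) ∣ c → ∃ k : ℤ, logPetersson (p * w) = logPetersson ((z + k) / p) := by
    intro hc
    obtain ⟨k, e, rfl⟩ := exists_int_mul_congr hc d
    refine ⟨k, logPetersson_moebius (a := a * p) (b := b - a * k) (c := c) (d := e)
      (by linear_combination hdet) (him2 k) ?_⟩
    push_cast at hw ⊢
    field_simp
    linear_combination hw
  have a1 : (p : ℤ) ∣ a → logPetersson (w / p) = logPetersson (p * z) := by
    rintro ⟨a, rfl⟩
    refine logPetersson_moebius (a := a) (b := b) (c := c) (d := p * d)
      (by linear_combination hdet) him1 ?_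
    push_cast at hw ⊢
    field_simp
    linear_combination hw
  have a2 : ¬(p : ℤ) ∣ a → ∃ k : ℤ, logPetersson (w / p) = logPetersson ((z + k) / p) := by
    intro ha
    obtain ⟨k, e, rfl⟩ := exists_int_mul_congr ha b
    refine ⟨k, logPetersson_moebius (a := a) (b := e) (c := c * p) (d := d - c * k)
      (by linear_combination hdet) (him2 k) ?_⟩
    push_cast at hw ⊢
    field_simp
    linear_combination hw
  by_cases hc : (p : ℤ) ∣ c
  · have ha : ¬(p : ℤ) ∣ a := fun ha => by
      have h1 : (p : ℤ) ∣ 1 := hdet ▸ dvd_sub (ha.mul_right d) (hc.mul_left b)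
      exact (Nat.prime_iff_prime_int.mp (Fact.out : p.Prime)).not_dvd_one h1
    obtain ⟨k, hk⟩ := a2 ha
    exact Or.inl ⟨k, by rw [c1 hc, hk]⟩
  · obtain ⟨k, hk⟩ := c2 hc
    by_cases ha : (p : ℤ) ∣ a
    · exact Or.inl ⟨k, by rw [a1 ha, hk, add_comm]⟩
    · obtain ⟨l, hl⟩ := a2 ha
      exact Or.inr ⟨k, l, by rw [hk, hl]⟩

end SplitCartan

/-! ### The two real-variable estimates -/

/-- The final estimate when `p * z` occurs (`s = √p`, `l = log p`, `y = Im z`). -/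
theorem cusp_estimate {K p s l y f₀ f₁ f₂ L V : ℝ} (hK : 0 ≤ K) (hp : 3 ≤ p) (hs : s ^ 2 = p)
    (hs0 : 0 ≤ s) (hl : l = Real.log p) (hsy : s ≤ y) (hL : L ≤ 2 * Real.pi * y + K)
    (hf₁ : f₁ ≤ -(2 * Real.pi * (p * y)) + 6 * (l + Real.log y) + K)
    (hf₀ : -(2 * Real.pi * y) + 6 * Real.log y - K ≤ f₀) (hf₂ : f₂ ≤ K)
    (hf₂' : p ≤ y → f₂ ≤ -(2 * Real.pi * (y / p)) + 6 * (Real.log y - l) + K)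
    (hV : V = 12 * p * l + p * (f₁ + f₂ - 2 * f₀)) :
    L ≤ 1 / (2 * (p - 1)) * |V| + 2 * Real.pi * s - 6 * l + (4 * K + 30) := by
  have hpi := Real.pi_gt_three
  have hpi' := Real.pi_lt_four
  have hp0 : 0 < p := by linarith
  have hs1 : 17 / 10 ≤ s := by nlinarith
  have hy0 : 0 < y := by linarith
  have hl0 : 0 ≤ l := hl ▸ Real.log_nonneg (by linarith)
  have hls : l = 2 * Real.log s := by rw [hl, ← hs, Real.log_pow]; norm_num
  have hlsy : l ≤ 2 * Real.log y := by
    rw [hls]; linarith [Real.log_le_log (by linarith : 0 < s) hsy]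
  -- Tangent line to log at 4. The slope 1/4 is small enough for 69/4 · l, the total log term at the
  -- end, to be absorbed by 51/10 · (p − 1) and the constant 30.
  have hl4 : l ≤ p / 4 + 1 := by
    have h1 := Real.log_le_sub_one_of_pos (show 0 < p / 4 by positivity)
    have h2 : Real.log 4 ≤ 2 := by
      have := Real.log_two_lt_d9
      rw [show (4 : ℝ) = 2 ^ 2 by norm_num, Real.log_pow]
      norm_num
      linarith
    rw [Real.log_div hp0.ne' (by norm_num), ← hl] at h1
    linarith
  -- For y ≤ p only f₂ ≤ K is available; the missing term −2πy/p is then at least −2π, which costs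
  -- the summand 2π.
  have hF : f₁ + f₂ - 2 * f₀ ≤
      -(2 * Real.pi * ((p - 2) * y + y / p)) + 3 * l + 4 * K + 2 * Real.pi := by
    rcases le_total p y with h | h
    · have := hf₂' h
      nlinarith
    · have h1 : y / p ≤ 1 := (div_le_one hp0).mpr h
      have h2 : 2 * Real.pi * (y / p) ≤ 2 * Real.pi * 1 :=
        mul_le_mul_of_nonneg_left h1 (by linarith)
      nlinarith
  have hyp : p * (y / p) = y := by field_simp
  have hV' : 2 * Real.pi * (p - 1) ^ 2 * y - p * (15 * l + 4 * K + 2 * Real.pi) ≤ |V| := by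
    refine le_trans ?_ (neg_le_abs V)
    have h1 := mul_le_mul_of_nonneg_left hF hp0.le
    have h2 : p * (-(2 * Real.pi * ((p - 2) * y + y / p)) + 3 * l + 4 * K + 2 * Real.pi) =
        -(2 * Real.pi * (p - 1) ^ 2 * y) + p * (3 * l + 4 * K + 2 * Real.pi) := by
      linear_combination (-2 * Real.pi) * hyp
    rw [hV]
    linarith
  -- The factor 3/4 bounds p/(2(p − 1)) for p ≥ 3.
  have hX : Real.pi * (p - 1) * y - 3 / 4 * (15 * l + 4 * K + 2 * Real.pi) ≤
      1 / (2 * (p - 1)) * |V| := by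
    rw [one_div, ← div_eq_inv_mul, le_div_iff₀ (by linarith)]
    refine le_trans ?_ hV'
    have h1 : 0 ≤ (15 * l + 4 * K + 2 * Real.pi) * (p - 3) :=
      mul_nonneg (by linarith) (by linarith)
    nlinarith
  have h1 : Real.pi * (p - 3) * s ≤ Real.pi * (p - 3) * y :=
    mul_le_mul_of_nonneg_left hsy (mul_nonneg (by linarith) (by linarith))
  have h2 : 51 / 10 ≤ Real.pi * s := by nlinarith
  have h3 : 51 / 10 * (p - 1) ≤ Real.pi * s * (p - 1) :=
    mul_le_mul_of_nonneg_right h2 (by linarith)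
  nlinarith

/-- The final estimate when `p * z` does not occur (`s = √p`, `l = log p`, `y = Im z`). -/
theorem noncusp_estimate {K p s l y f₀ f₁ f₂ L V : ℝ} (hK : 0 ≤ K) (hp : 3 ≤ p)
    (hs : s ^ 2 = p) (hs0 : 0 ≤ s) (hl : l = Real.log p) (hsy : s + 3 / Real.pi * l ≤ y)
    (hL : L ≤ 2 * Real.pi * y + K)
    (hf₀ : f₀ ≤ -(2 * Real.pi * y) + 6 * Real.log y + K)
    (hf₁ : y ≤ p → -(2 * Real.pi * (p / y)) - K ≤ f₁)
    (hf₂ : y ≤ p → -(2 * Real.pi * (p / y)) - K ≤ f₂)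
    (hf₁' : p ≤ y → -(2 * Real.pi * (y / p)) + 6 * (Real.log y - l) - K ≤ f₁)
    (hf₂' : p ≤ y → -(2 * Real.pi * (y / p)) + 6 * (Real.log y - l) - K ≤ f₂)
    (hV : V = 12 * p * l + p * (f₁ + f₂ - 2 * f₀)) :
    L ≤ 1 / (2 * (p - 1)) * |V| + 2 * Real.pi * s - 6 * l + (4 * K + 200) := by
  have hpi := Real.pi_gt_three
  have hpi' := Real.pi_lt_four
  have hp0 : 0 < p := by linarith
  have hs1 : 17 / 10 ≤ s := by nlinarith
  have hl0 : 0 ≤ l := hl ▸ Real.log_nonneg (by linarith)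
  have hls : l = 2 * Real.log s := by rw [hl, ← hs, Real.log_pow]; norm_num
  set t := 3 / Real.pi * l with ht
  have hpt : Real.pi * t = 3 * l := by rw [ht]; field_simp
  have ht0 : 0 ≤ t := by positivity
  have hy0 : 0 < y := by linarith
  have hVabs := le_abs_self V
  have hX : ∀ W : ℝ, 2 * (p - 1) * W ≤ V → W ≤ 1 / (2 * (p - 1)) * |V| := fun W h => by
    rw [one_div, ← div_eq_inv_mul, le_div_iff₀ (by linarith)]
    linarith
  rcases le_total y p with h | h
  · have hly : Real.log y ≤ l := hl ▸ Real.log_le_log hy0 h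
    -- Since s = √p, l = 4 log √s ≤ 4√s. This makes the error t²/(s + t) in p/(s + t) = s − t +
    -- t²/(s + t) bounded.
    have hls2 : l ^ 2 ≤ 16 * s := by
      have hr := Real.log_le_sub_one_of_pos (Real.sqrt_pos.mpr (by linarith : 0 < s))
      rw [Real.log_sqrt hs0] at hr
      have hr2 := Real.sq_sqrt hs0
      have : l ≤ 4 * Real.sqrt s := by linarith
      nlinarith
    have htl : t ≤ l := by nlinarith
    have ht2 : t ^ 2 ≤ 16 * s := le_trans (pow_le_pow_left₀ ht0 htl 2) hls2
    have hpy : p / y ≤ s - t + 16 := by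
      have h1 : p / y ≤ p / (s + t) := div_le_div_of_nonneg_left hp0.le (by linarith) hsy
      refine h1.trans ((div_le_iff₀ (by linarith)).mpr ?_)
      nlinarith
    have hpy' := mul_le_mul_of_nonneg_left hpy (show 0 ≤ 4 * Real.pi by linarith)
    have hF : 4 * Real.pi * y - 4 * Real.pi * s - (4 * K + 64 * Real.pi) ≤
        f₁ + f₂ - 2 * f₀ := by
      have := hf₁ h
      have := hf₂ h
      linarith
    have hF' := mul_le_mul_of_nonneg_left hF hp0.le
    -- Nonnegativity allows the factor p of this main term to be lowered to p − 1; the error term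
    -- instead uses p ≤ 3(p − 1)/2.
    have hA : 0 ≤ 12 * l + 4 * Real.pi * y - 4 * Real.pi * s := by nlinarith
    have := hX ((12 * l + 4 * Real.pi * y - 4 * Real.pi * s) / 2 - 3 / 4 * (4 * K + 64 * Real.pi))
      (by
        rw [hV]
        have h1 : 0 ≤ (4 * K + 64 * Real.pi) * (p - 3) := mul_nonneg (by linarith) (by linarith)
        linarith)
    linarith
  -- For y ≥ p the bound obtained lacks 2πs − 6l, which may be added because it is nonnegative.
  · have hls3 : 6 * l ≤ 6 * s := by
      have h1 := Real.log_le_sub_one_of_pos (show 0 < s / 2 by linarith)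
      rw [Real.log_div (by linarith) (by norm_num)] at h1
      have := Real.log_two_lt_d9
      linarith
    have hyp : p * (y / p) = y := by field_simp
    have hF : 4 * Real.pi * y - 4 * Real.pi * (y / p) - 12 * l - 4 * K ≤ f₁ + f₂ - 2 * f₀ := by
      have := hf₁' h
      have := hf₂' h
      linarith
    have hF' := mul_le_mul_of_nonneg_left hF hp0.le
    have h2 : p * (4 * Real.pi * y - 4 * Real.pi * (y / p) - 12 * l - 4 * K) =
        4 * Real.pi * (p - 1) * y - 12 * p * l - 4 * K * p := by
      linear_combination (-4 * Real.pi) * hyp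
    have := hX (2 * Real.pi * y - 3 * K) (by
      rw [hV]
      have h1 : 0 ≤ K * (p - 3) := mul_nonneg hK (by linarith)
      linarith)
    nlinarith

/-! ### Assembly of the estimates -/

theorem proposition4p1 :
    ∃ C : ℝ, ∀ (p : ℕ) [Fact p.Prime] (hp : 3 ≤ p) (P : SplitCartan.Y p),
      Real.log ‖SplitCartan.jY P‖ ≤ 2 * Real.pi * Real.sqrt p + 6 * Real.log p + C ∨
      Real.log ‖SplitCartan.jY P‖ ≤
        1 / (2 * ((p : ℝ) - 1)) * |Real.log ‖SplitCartan.UY hp P‖| +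
          2 * Real.pi * Real.sqrt p - 6 * Real.log p + C := by
  obtain ⟨K₁, hK₁⟩ := SplitCartan.exists_logPetersson_bound
  obtain ⟨K₂, hK₂⟩ := SplitCartan.exists_logPetersson_le
  obtain ⟨K₃, hK₃⟩ := SplitCartan.exists_le_logPetersson
  obtain ⟨K₄, hK₄⟩ := SplitCartan.exists_log_norm_jInv_le
  obtain ⟨K, hK, k₁, k₂, k₃, k₄⟩ : ∃ K : ℝ, 0 ≤ K ∧ K₁ ≤ K ∧ K₂ ≤ K ∧ K₃ ≤ K ∧ K₄ ≤ K := by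
    refine ⟨|K₁| + |K₂| + |K₃| + |K₄|, by positivity, ?_, ?_, ?_, ?_⟩ <;>
    linarith [le_abs_self K₁, le_abs_self K₂, le_abs_self K₃, le_abs_self K₄, abs_nonneg K₁,
      abs_nonneg K₂, abs_nonneg K₃, abs_nonneg K₄]
  refine ⟨4 * K + 200, fun p _ hp P => ?_⟩
  induction P using Quotient.inductionOn with | h τ => ?_
  change Real.log ‖SplitCartan.jInv τ‖ ≤ _ ∨ Real.log ‖SplitCartan.jInv τ‖ ≤
    1 / (2 * ((p : ℝ) - 1)) * |Real.log ‖SplitCartan.U p τ‖| + _ - _ + _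
  have hp3 : (3 : ℝ) ≤ p := by exact_mod_cast hp
  have hp0 : (0 : ℝ) < p := by linarith
  obtain ⟨z, γ, hz, rfl⟩ := SplitCartan.exists_moebius_fd τ
  have hzi := SplitCartan.one_half_le_im_of_mem_fd hz
  have hL : Real.log ‖SplitCartan.jInv (γ • z)‖ ≤ 2 * Real.pi * z.im + K := by
    rw [SplitCartan.jInv_smul]
    exact (hK₄ z hz).trans (by linarith)
  have hV := SplitCartan.log_norm_U p (γ • z)
  have h0 : SplitCartan.logPetersson ((γ • z : UpperHalfPlane) : ℂ) =
      SplitCartan.logPetersson z := SplitCartan.logPetersson_moebius (SplitCartan.det_entries γ)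
        z.im_pos (SplitCartan.coe_smul_mul γ z)
  rw [h0] at hV
  have b0 := abs_le.mp (hK₁ z hzi)
  simp only [UpperHalfPlane.coe_im] at b0
  have hs : Real.sqrt p ^ 2 = (p : ℝ) := Real.sq_sqrt hp0.le
  have hs0 := Real.sqrt_nonneg (p : ℝ)
  have hl0 : 0 ≤ Real.log p := Real.log_nonneg (by linarith)
  have hpi := Real.pi_gt_three
  have him : ∀ k : ℤ, (((z : ℂ) + k) / p).im = z.im / p := fun k => by
    rw [← Complex.ofReal_natCast, Complex.div_ofReal_im]; simp
  have hle : ∀ k : ℤ, SplitCartan.logPetersson (((z : ℂ) + k) / p) ≤ K := fun k =>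
    (hK₂ _ (him k ▸ div_pos z.im_pos hp0)).trans k₂
  have hge : ∀ k : ℤ, z.im ≤ p →
      -(2 * Real.pi * (p / z.im)) - K ≤ SplitCartan.logPetersson (((z : ℂ) + k) / p) :=
    fun k h => by
      have h1 := hK₃ (((z : ℂ) + k) / p) (him k ▸ div_pos z.im_pos hp0)
        (him k ▸ (div_le_one hp0).mpr h)
      rw [him k, div_div_eq_mul_div, mul_div_assoc] at h1
      linarith
  have habs : ∀ k : ℤ, p ≤ z.im →
      |SplitCartan.logPetersson (((z : ℂ) + k) / p) + 2 * Real.pi * (z.im / p) -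
        6 * (Real.log z.im - Real.log p)| ≤ K := fun k h => by
    have h1 : 1 ≤ z.im / p := (one_le_div hp0).mpr h
    have h2 := hK₁ (((z : ℂ) + k) / p) (him k ▸ by linarith)
    rw [him k, Real.log_div z.im_pos.ne' hp0.ne'] at h2
    exact h2.trans k₁
  -- The threshold is the largest height at which 2πy still fits under 2π√p + 6 log p.
  rcases le_total z.im (Real.sqrt p + 3 / Real.pi * Real.log p) with hy | hy
  · left
    have h1 := mul_le_mul_of_nonneg_left hy Real.two_pi_pos.le
    have h2 : 2 * Real.pi * (Real.sqrt p + 3 / Real.pi * Real.log p) =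
        2 * Real.pi * Real.sqrt p + 6 * Real.log p := by field_simp; ring
    linarith
  · right
    rcases SplitCartan.logPetersson_hecke (p := p) γ z with ⟨k, hk⟩ | ⟨k, l, hk⟩ <;> rw [hk] at hV
    · have hpz : ((p : ℂ) * z).im = p * z.im := by
        rw [← Complex.ofReal_natCast, Complex.im_ofReal_mul]; rfl
      have b1 := (abs_le.mp (hK₁ (p * z) (by rw [hpz]; nlinarith))).2
      rw [hpz, Real.log_mul hp0.ne' z.im_pos.ne'] at b1
      have hsy : Real.sqrt p ≤ z.im := by
        have : 0 ≤ 3 / Real.pi * Real.log p := by positivity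
        linarith
      have := cusp_estimate hK hp3 hs hs0 rfl hsy hL (by linarith) (by linarith) (hle k)
        (fun h => by linarith [(abs_le.mp (habs k h)).2]) hV
      linarith
    · exact noncusp_estimate hK hp3 hs hs0 rfl hy hL (by linarith) (hge k) (hge l)
        (fun h => by linarith [(abs_le.mp (habs k h)).1])
        (fun h => by linarith [(abs_le.mp (habs l h)).1]) hV
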